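/- Let $\mathbb{K}$ be $\mathbb{R}$ or $\mathbb{Q}$ (or, more generally, any linearly ordered field) and let $n \ge 0$. A tropical polynomial $p$ over $\mathbb{K}$ in $n$ variables is given by a finite set $\mathrm{Supp}(p) \subseteq \mathbb{N}^n$ and a coefficient $c_J \in \mathbb{K}$ for each $J \in \mathrm{Supp}(p)$; its monomials are the functions $c_J + \langle J, x\rangle = c_J + j_1x_1 + \dots + j_nx_n$. It is nontrivial if $\mathrm{Supp}(p) \neq \emptyset$. A point $a \in \mathbb{K}^n$ is a root of $p$ if $\max_{J \in \mathrm{Supp}(p)} (c_J + \langle J, a\rangle)$ is attained for at least two distinct $J$, and $p$ vanishes on a set $R \subseteq \mathbb{K}^n$ if every point of $R$ is a root of $p$. Finite sets $S \subseteq \mathbb{N}^n$ and $R \subseteq \mathbb{K}^n$ with $|S| = |R|$ are called non-singular if there is a bijection $f\colon S \to R$ such that $\sum_{J \in S} \langle J, f(J)\rangle$ is strictly greater than the corresponding sum for every other bijection from $S$ to $R$; otherwise they are called singular. Let $S \subseteq \mathbb{N}^n$ and $R \subseteq \mathbb{K}^n$ be finite. (i) If $|R| < |S|$, then there is a nontrivial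 tropical polynomial $p$ with $\mathrm{Supp}(p) \subseteq S$ vanishing on $R$. (ii) If $|R| = |S|$, then there is a nontrivial tropical polynomial $p$ with $\mathrm{Supp}(p) \subseteq S$ vanishing on $R$ if and only if $S$ and $R$ are singular. (iii) If $|R| > |S|$, then there is a nontrivial tropical polynomial $p$ with $\mathrm{Supp}(p) \subseteq S$ vanishing on $R$ if and only if for every subset $R' \subset R$ with $|R'| = |S|$ the sets $S$ and $R'$ are singular. Moreover, whenever there is a nontrivial tropical polynomial with support contained in $S$ vanishing on $R$, there is also a nontrivial one with support equal to $S$ vanishing on $R$. -/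

import Mathlib

/-- The inner product `⟨J, a⟩ = j₁ a₁ + ⋯ + jₙ aₙ` of an exponent vector `J ∈ ℕⁿ` and a point
`a ∈ Kⁿ`. It is also the value at `a` of the tropical power product `x^J`. -/
def expPairing {K : Type*} [Semiring K] {n : ℕ} (J : Fin n → ℕ) (a : Fin n → K) : K :=
  ∑ i, (J i : K) * a i

/-- A tropical (max-plus) polynomial in `n` variables over `K`: a finite set of exponent vectors
(those of the monomials that occur) with a coefficient in `K` for each of them. The polynomial
without monomials is allowed. -/
structure TropicalPolynomial (K : Type*) (n : ℕ) where
  /-- The set `Supp(p)` of exponent vectors of the monomials that occur in `p`. -/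
  support : Finset (Fin n → ℕ)
  /-- The coefficient of each monomial that occurs. -/
  coeff : support → K

namespace TropicalPolynomial

/-- The value `c_J + j₁ a₁ + ⋯ + jₙ aₙ` at the point `a` of the monomial of `p` with exponent
vector `J`. -/
def monomialValue {K : Type*} [Semiring K] {n : ℕ} (p : TropicalPolynomial K n)
    (J : p.support) (a : Fin n → K) : K :=
  p.coeff J + expPairing J.1 a

/-- `a` is a root of `p`: the maximum over the monomials of `p` of their values at `a` is
attained on at least two distinct monomials. -/
def IsRoot {K : Type*} [Semiring K] [LinearOrder K] {n : ℕ} (p : TropicalPolynomial K n)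
    (a : Fin n → K) : Prop :=
  ∃ J₁ J₂ : p.support, J₁ ≠ J₂ ∧
    (∀ J : p.support, p.monomialValue J a ≤ p.monomialValue J₁ a) ∧
    (∀ J : p.support, p.monomialValue J a ≤ p.monomialValue J₂ a)

/-- `p` vanishes on `R`: every point of `R` is a root of `p`. -/
def VanishesOn {K : Type*} [Semiring K] [LinearOrder K] {n : ℕ} (p : TropicalPolynomial K n)
    (R : Finset (Fin n → K)) : Prop :=
  ∀ a ∈ R, p.IsRoot a

end TropicalPolynomial

/-- `S` and `R` are non-singular: some bijection `f : S → R` has a sum `∑_{J ∈ S} ⟨J, f(J)⟩`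
greater than the corresponding sum of every other bijection from `S` to `R`. The notion is meant
for, and only used with, sets of the same cardinality. -/
def NonSingular {K : Type*} [Semiring K] [LinearOrder K] {n : ℕ} (S : Finset (Fin n → ℕ))
    (R : Finset (Fin n → K)) : Prop :=
  ∃ f : S ≃ R, ∀ g : S ≃ R, g ≠ f →
    ∑ J : S, expPairing J.1 (g J).1 < ∑ J : S, expPairing J.1 (f J).1

/-- `S` and `R` (of the same cardinality) are singular: they are not non-singular. -/
def Singular {K : Type*} [Semiring K] [LinearOrder K] {n : ℕ} (S : Finset (Fin n → ℕ))
    (R : Finset (Fin n → K)) : Prop :=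
  ¬ NonSingular S R

/-! A polynomial with support `S` vanishing on `R` is a tropical dependency between the columns of
the matrix with entries `⟨J, a⟩`, and non-singularity is uniqueness of the optimal assignment. With
fewer rows than columns, or a square matrix without unique optimum, tropical cofactors give a
dependency, as in Cramer's rule; `exists_dependency_of_forall_card_le` reduces more rows to these
cases. Conversely, by `exists_perm_of_dependency`, even a dependency on some columns rules out a
unique optimum. So partial support forces singularity, which yields full support. -/

/-- The family `v` attains its maximum at two distinct indices. -/
def AttainsMaxTwice {ι K : Type*} [LE K] (v : ι → K) : Prop :=
  ∃ j₁ j₂, j₁ ≠ j₂ ∧ (∀ j, v j ≤ v j₁) ∧ ∀ j, v j ≤ v j₂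

section TropicalLinearAlgebra

variable {I J K : Type*} [Fintype J] [AddCommGroup K]

/-- A permutation meets row `l₀` in exactly one column, so that row's contribution splits off. -/
theorem sum_update_row [DecidableEq J] (B : J → J → K) (l₀ : J) (v : J → K)
    (e : Equiv.Perm J) :
    ∑ j, Function.update B l₀ v (e j) j =
      ∑ j, Function.update B l₀ 0 (e j) j + v (e.symm l₀) := by
  have h : ∀ j, Function.update B l₀ v (e j) j =
      Function.update B l₀ 0 (e j) j + if j = e.symm l₀ then v j else 0 := by
    intro j
    by_cases hj : e j = l₀
    · have hj' : j = e.symm l₀ := by rw [← hj, Equiv.symm_apply_apply]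
      rw [if_pos hj', hj]
      simp
    · have hj' : j ≠ e.symm l₀ := fun h => hj (by rw [h, Equiv.apply_symm_apply])
      simp [hj, hj']
  simp [h, Finset.sum_add_distrib]

variable [LinearOrder K] [IsOrderedAddMonoid K]

/-- Tropical cofactor expansion: the tropical cofactors `c` of a square matrix along the row `l₀`
are such that, if this row is replaced by a row `v`, then every optimal permutation of the new
matrix yields a maximal entry of `c + v`. -/
theorem exists_tropical_cofactors [DecidableEq J] (B : J → J → K) (l₀ : J) :
    ∃ c : J → K, ∀ (v : J → K) (e : Equiv.Perm J),
      (∀ e' : Equiv.Perm J, ∑ j, Function.update B l₀ v (e' j) j ≤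
        ∑ j, Function.update B l₀ v (e j) j) →
      ∀ j, c j + v j ≤ c (e.symm l₀) + v (e.symm l₀) := by
  -- The cofactor at `j` is the best sum over permutations sending `j` to `l₀`, with row `l₀`
  -- zeroed; adding `v j` gives the best such sum for the row `v`.
  have h : ∀ j : J, ∃ e : Equiv.Perm J, e.symm l₀ = j ∧
      ∀ e' : Equiv.Perm J, e'.symm l₀ = j →
        ∑ j, Function.update B l₀ 0 (e' j) j ≤ ∑ j, Function.update B l₀ 0 (e j) j := by
    intro j
    obtain ⟨e, he, hmax⟩ := Finset.exists_max_image
      (Finset.univ.filter fun e : Equiv.Perm J => e.symm l₀ = j)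
      (fun e => ∑ j, Function.update B l₀ 0 (e j) j)
      ⟨Equiv.swap l₀ j, by simp⟩
    exact ⟨e, by simpa using he, fun e' he' => hmax e' (by simpa using he')⟩
  choose E hE hmax using h
  refine ⟨fun j => ∑ j', Function.update B l₀ 0 (E j j') j', fun v e he j => ?_⟩
  have h₁ := he (E j)
  rw [sum_update_row, sum_update_row B l₀ v e, hE] at h₁
  exact h₁.trans (add_le_add_left (hmax _ e rfl) _)

/-- A square tropical matrix whose row `l₀` is assigned to two different columns by two optimal
permutations, or whose row `l₀` is ignored, has a tropical dependency between its columns. -/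
theorem exists_dependency_of_square (B : J → J → K) (l₀ : J) :
    ∃ c : J → K, (∀ l, l ≠ l₀ → AttainsMaxTwice fun j => c j + B l j) ∧
      ∀ σ τ : Equiv.Perm J, σ.symm l₀ ≠ τ.symm l₀ →
        (∀ e : Equiv.Perm J, ∑ j, B (e j) j ≤ ∑ j, B (σ j) j) →
        (∀ e : Equiv.Perm J, ∑ j, B (e j) j ≤ ∑ j, B (τ j) j) →
        AttainsMaxTwice fun j => c j + B l₀ j := by
  classical
  obtain ⟨c, hc⟩ := exists_tropical_cofactors B l₀
  refine ⟨c, fun l hl => ?_, fun σ τ hne hσ hτ =>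
    ⟨_, _, hne, hc (B l₀) σ (by simpa using hσ), hc (B l₀) τ (by simpa using hτ)⟩⟩
  obtain ⟨e, he⟩ := Finite.exists_max fun e : Equiv.Perm J =>
    ∑ j, Function.update B l₀ (B l) (e j) j
  -- Row `l₀` is now a copy of row `l`; swapping equal rows keeps the sum but moves `l₀` to another
  -- column.
  have hswap : ∑ j, Function.update B l₀ (B l) ((e.trans (Equiv.swap l₀ l)) j) j =
      ∑ j, Function.update B l₀ (B l) (e j) j := by
    refine Finset.sum_congr rfl fun j _ => ?_
    rw [Equiv.trans_apply]
    by_cases h₀ : e j = l₀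
    · simp [h₀, hl]
    · by_cases h₁ : e j = l
      · simp [h₁, hl]
      · rw [Equiv.swap_apply_of_ne_of_ne h₀ h₁]
  exact ⟨_, _, fun h => hl (by simpa using h.symm), hc (B l) e he,
    hc (B l) (e.trans (Equiv.swap l₀ l)) (by rw [hswap]; exact he)⟩

/-- A tropical matrix with fewer rows than columns has a tropical dependency between its
columns. -/
theorem exists_dependency_of_card_lt [Fintype I] (A : I → J → K)
    (h : Fintype.card I < Fintype.card J) :
    ∃ c : J → K, ∀ i, AttainsMaxTwice fun j => c j + A i j := by
  obtain ⟨ι⟩ := Function.Embedding.nonempty_of_card_le h.le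
  have hns : ¬ Function.Surjective ι := fun hs =>
    h.not_ge (Fintype.card_le_of_surjective ι hs)
  obtain ⟨l₀, hl₀⟩ := not_forall.1 hns
  obtain ⟨c, hc, -⟩ := exists_dependency_of_square (Function.extend ι A 0) l₀
  refine ⟨c, fun i => ?_⟩
  have := hc (ι i) fun hi => hl₀ ⟨i, hi⟩
  rwa [ι.injective.extend_apply] at this

/-- A square tropical matrix without a unique optimal permutation has a tropical dependency
between its columns. -/
theorem exists_dependency_of_singular (B : J → J → K)
    (h : ∀ τ : Equiv.Perm J, ∃ σ : Equiv.Perm J, σ ≠ 1 ∧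
      ∑ j, B (τ j) j ≤ ∑ j, B (τ (σ j)) j) :
    ∃ c : J → K, ∀ l, AttainsMaxTwice fun j => c j + B l j := by
  obtain ⟨τ, hτ⟩ := Finite.exists_max fun e : Equiv.Perm J => ∑ j, B (e j) j
  obtain ⟨σ, hσ, hle⟩ := h τ
  obtain ⟨j, hj⟩ : ∃ j, σ j ≠ j := by
    by_contra! hall
    exact hσ (Equiv.ext hall)
  obtain ⟨c, hc, hc₀⟩ := exists_dependency_of_square B (τ j)
  refine ⟨c, fun l => ?_⟩
  by_cases hl : l = τ j
  · subst hl
    refine hc₀ τ (σ.trans τ) ?_ hτ fun e => (hτ e).trans hle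
    intro heq
    apply hj
    rw [Equiv.symm_trans_apply, Equiv.symm_apply_apply, Equiv.eq_symm_apply] at heq
    exact heq
  · exact hc l hl

/-- Helly's theorem for tropical hyperplanes: if any `|J|` rows of a tropical matrix admit a common
dependency between the columns `J`, then all rows do. -/
theorem exists_dependency_of_forall_card_le [Nonempty J] (A : I → J → K)
    (h : ∀ T : Finset I, T.card ≤ Fintype.card J →
      ∃ c : J → K, ∀ i ∈ T, AttainsMaxTwice fun j => c j + A i j) (T : Finset I) :
    ∃ c : J → K, ∀ i ∈ T, AttainsMaxTwice fun j => c j + A i j := by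
  classical
  induction T using Finset.strongInduction with
  | H T ih =>
    obtain hT | hT := le_or_gt T.card (Fintype.card J)
    · exact h T hT
    choose c hc using fun i : T => ih (T.erase i.1) (Finset.erase_ssubset i.2)
    -- Each `c i` serves all rows of `T` but `i`. Being more than `|J|` vectors, they are dependent:
    -- their maximum `C`, shifted by `d`, is attained twice in every coordinate.
    obtain ⟨d, hd⟩ := exists_dependency_of_card_lt (fun (j : J) (i : T) => c i j) (by simpa using hT)
    choose i₁ i₂ hne h₁ h₂ using hd
    let C : J → K := fun j => d (i₁ j) + c (i₁ j) j
    refine ⟨C, fun i hi => ?_⟩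
    obtain ⟨j₀, hj₀⟩ := Finite.exists_max fun j => C j + A i j
    obtain ⟨i', hi', hC⟩ : ∃ i' : T, i' ≠ ⟨i, hi⟩ ∧ C j₀ = d i' + c i' j₀ := by
      by_cases hi₁ : i₁ j₀ = ⟨i, hi⟩
      · exact ⟨i₂ j₀, fun h' => hne j₀ (hi₁.trans h'.symm), le_antisymm (h₂ j₀ _) (h₁ j₀ _)⟩
      · exact ⟨i₁ j₀, hi₁, rfl⟩
    obtain ⟨k₁, k₂, hk, hk₁, hk₂⟩ := hc i' i
      (Finset.mem_erase.2 ⟨fun h' => hi' (Subtype.ext h'.symm), hi⟩)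
    -- `d i' + c i'` lies below `C` and touches it at `j₀`, so maximisers for `c i'` in row `i` are
    -- maximisers for `C`.
    have key : ∀ k, (∀ j, c i' j + A i j ≤ c i' k + A i k) → ∀ j, C j + A i j ≤ C k + A i k := by
      intro k hk j
      calc C j + A i j ≤ C j₀ + A i j₀ := hj₀ j
        _ = d i' + (c i' j₀ + A i j₀) := by rw [hC, add_assoc]
        _ ≤ d i' + (c i' k + A i k) := add_le_add_right (hk j₀) _
        _ = (d i' + c i' k) + A i k := (add_assoc _ _ _).symm
        _ ≤ C k + A i k := add_le_add_left (h₁ k i') _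
    exact ⟨k₁, k₂, hk, key k₁ hk₁, key k₂ hk₂⟩

/-- If no injection of the columns into the rows is uniquely optimal on its range, then the columns
of a tropical matrix are tropically dependent. -/
theorem exists_dependency [Nonempty J] (A : I → J → K) (T : Finset I)
    (h : ∀ f : J → I, Function.Injective f → (∀ j, f j ∈ T) →
      ∃ σ : Equiv.Perm J, σ ≠ 1 ∧ ∑ j, A (f j) j ≤ ∑ j, A (f (σ j)) j) :
    ∃ c : J → K, ∀ i ∈ T, AttainsMaxTwice fun j => c j + A i j := by
  obtain ⟨c, hc⟩ := exists_dependency_of_forall_card_le (fun (i : T) j => A i j) (fun U hU => by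
    obtain hU | hU := hU.lt_or_eq
    · obtain ⟨c, hc⟩ := exists_dependency_of_card_lt (fun (i : U) j => A i j) (by simpa using hU)
      exact ⟨c, fun i hi => hc ⟨i, hi⟩⟩
    · have e : J ≃ U := Fintype.equivOfCardEq (by simp [hU])
      obtain ⟨c, hc⟩ := exists_dependency_of_singular (fun l j => A (e l) j) fun τ =>
        h (fun j => e (τ j))
          (fun a b hab => τ.injective (e.injective (Subtype.ext (Subtype.ext hab))))
          fun j => (e (τ j)).1.2
      refine ⟨c, fun i hi => ?_⟩
      simpa using hc (e.symm ⟨i, hi⟩)) Finset.univ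
  exact ⟨c, fun i hi => hc ⟨i, hi⟩ (Finset.mem_univ _)⟩

/-- A tropical dependency between some of the columns of a square matrix shows that the identity
is not the unique optimal permutation. -/
theorem exists_perm_of_dependency [Nonempty J] (B : J → J → K) (c : J → K) (s : Set J)
    (h : ∀ l, ∃ j₁ ∈ s, ∃ j₂ ∈ s, j₁ ≠ j₂ ∧ (∀ j ∈ s, c j + B l j ≤ c j₁ + B l j₁) ∧
      ∀ j ∈ s, c j + B l j ≤ c j₂ + B l j₂) :
    ∃ σ : Equiv.Perm J, σ ≠ 1 ∧ ∑ j, B j j ≤ ∑ j, B j (σ j) := by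
  classical
  have h' : ∀ l, ∃ k ∈ s, k ≠ l ∧ ∀ j ∈ s, c j + B l j ≤ c k + B l k := by
    intro l
    obtain ⟨j₁, hj₁, j₂, hj₂, hne, h₁, h₂⟩ := h l
    by_cases hl : j₁ = l
    · exact ⟨j₂, hj₂, fun h => hne (hl.trans h.symm), h₂⟩
    · exact ⟨j₁, hj₁, hl, h₁⟩
  choose p hps hpne hpmax using h'
  -- The self-map `p` permutes its periodic points; `σ` follows its cycles and fixes the rest.
  have hbij := Function.bijOn_periodicPts p
  let σ : Equiv.Perm J := Equiv.Perm.ofSubtype (hbij.equiv p)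
  have hσ : ∀ j ∈ Function.periodicPts p, σ j = p j := fun j hj =>
    Equiv.Perm.ofSubtype_apply_of_mem _ hj
  have hσ' : ∀ j, j ∉ Function.periodicPts p → σ j = j := fun j hj =>
    Equiv.Perm.ofSubtype_apply_of_not_mem _ hj
  -- The diagonal entry at `j` can be compared with the one at `p j` only if `j` lies in `s`.
  have hmem : ∀ j ∈ Function.periodicPts p, j ∈ s := by
    intro j hj
    obtain ⟨k, -, rfl⟩ := hbij.surjOn hj
    exact hps k
  refine ⟨σ, fun h1 => ?_, ?_⟩
  · obtain ⟨j⟩ := ‹Nonempty J›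
    obtain ⟨m, n, hmn, heq⟩ : ∃ m n : ℕ, m < n ∧ p^[m] j = p^[n] j := by
      obtain ⟨m, n, hne, heq⟩ := Finite.exists_ne_map_eq_of_infinite fun m : ℕ => p^[m] j
      obtain hlt | hlt := hne.lt_or_gt
      · exact ⟨m, n, hlt, heq⟩
      · exact ⟨n, m, hlt, heq.symm⟩
    have hper : p^[m] j ∈ Function.periodicPts p := by
      refine Function.mk_mem_periodicPts (Nat.sub_pos_of_lt hmn) ?_
      change p^[n - m] (p^[m] j) = p^[m] j
      rw [← Function.iterate_add_apply, Nat.sub_add_cancel hmn.le, heq]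
    apply hpne (p^[m] j)
    rw [← hσ _ hper, h1, Equiv.Perm.one_apply]
  · have hsum : ∑ j, (c j + B j j) ≤ ∑ j, (c (σ j) + B j (σ j)) := by
      refine Finset.sum_le_sum fun j _ => ?_
      by_cases hj : j ∈ Function.periodicPts p
      · rw [hσ j hj]
        exact hpmax j j (hmem j hj)
      · rw [hσ' j hj]
    rw [Finset.sum_add_distrib, Finset.sum_add_distrib, Equiv.sum_comp σ c] at hsum
    exact le_of_add_le_add_left hsum

end TropicalLinearAlgebra

section TropicalPolynomials

variable {K : Type*} [Field K] [LinearOrder K] {n : ℕ}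

/-- A dependency between the monomials in `S` at the points of `R` is a tropical polynomial with
support `S` vanishing on `R`. -/
theorem exists_vanishesOn_of_dependency {S : Finset (Fin n → ℕ)} {R : Finset (Fin n → K)}
    (h : ∃ c : S → K, ∀ a ∈ R, AttainsMaxTwice fun J => c J + expPairing J.1 a) :
    ∃ p : TropicalPolynomial K n, p.support = S ∧ p.VanishesOn R := by
  obtain ⟨c, hc⟩ := h
  exact ⟨⟨S, c⟩, rfl, hc⟩

/-- Sets of exponents and points in bijection are singular if some nontrivial polynomial supported
on the exponents vanishes on the points. -/
theorem singular_of_vanishesOn [IsStrictOrderedRing K] {S : Finset (Fin n → ℕ)}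
    {R : Finset (Fin n → K)} (p : TropicalPolynomial K n) (hp : p.support.Nonempty)
    (hpS : p.support ⊆ S) (hpR : p.VanishesOn R) : Singular S R := by
  classical
  rintro ⟨f, hf⟩
  have : Nonempty S := (hp.mono hpS).to_subtype
  -- The value 0 off the support is never compared.
  let c : S → K := fun J => if h : J.1 ∈ p.support then p.coeff ⟨J.1, h⟩ else 0
  obtain ⟨σ, hσ, hle⟩ := exists_perm_of_dependency (fun l J : S => expPairing J.1 (f l).1) c
    {J | J.1 ∈ p.support} (fun l => by
      obtain ⟨J₁, J₂, hne, h₁, h₂⟩ := hpR (f l).1 (f l).2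
      refine ⟨⟨J₁, hpS J₁.2⟩, J₁.2, ⟨J₂, hpS J₂.2⟩, J₂.2,
        fun h => hne (Subtype.ext (Subtype.mk.inj h)), fun J hJ => ?_, fun J hJ => ?_⟩
      · have hJ : J.1 ∈ p.support := hJ
        simpa [c, hJ, TropicalPolynomial.monomialValue] using h₁ ⟨J.1, hJ⟩
      · have hJ : J.1 ∈ p.support := hJ
        simpa [c, hJ, TropicalPolynomial.monomialValue] using h₂ ⟨J.1, hJ⟩)
  refine (hf (σ.symm.trans f) fun h => hσ ?_).not_ge ?_
  · ext1 J
    have := f.injective (DFunLike.congr_fun h (σ J))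
    simpa using this.symm
  · refine hle.trans_eq ?_
    rw [← Equiv.sum_comp σ fun J => expPairing J.1 ((σ.symm.trans f) J).1]
    simp

/-- If `S` is nonempty and singular with every subset of `R` of the same cardinality, then some
polynomial with support `S` vanishes on `R`. -/
theorem exists_vanishesOn_of_singular [IsStrictOrderedRing K] {S : Finset (Fin n → ℕ)}
    {R : Finset (Fin n → K)} (hS : S.Nonempty)
    (h : ∀ R' : Finset (Fin n → K), R' ⊆ R → R'.card = S.card → Singular S R') :
    ∃ p : TropicalPolynomial K n, p.support = S ∧ p.VanishesOn R := by
  classical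
  have : Nonempty S := hS.to_subtype
  refine exists_vanishesOn_of_dependency
    (exists_dependency (fun a (J : S) => expPairing J.1 a) R fun f hf hfR => ?_)
  by_contra! hcon
  let R' : Finset (Fin n → K) := Finset.univ.image f
  let e : S ≃ R' := Equiv.ofBijective
    (fun J => ⟨f J, Finset.mem_image_of_mem f (Finset.mem_univ J)⟩)
    ⟨fun a b hab => hf (congrArg Subtype.val hab), fun a => by
      obtain ⟨J, -, hJ⟩ := Finset.mem_image.1 a.2
      exact ⟨J, Subtype.ext hJ⟩⟩
  refine h R' (Finset.image_subset_iff.2 fun J _ => hfR J)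
    (by simp [R', Finset.card_image_of_injective _ hf]) ⟨e, fun g hg => ?_⟩
  have hge : ∀ J, f ((g.trans e.symm) J) = (g J).1 := fun J =>
    congrArg Subtype.val (e.apply_symm_apply (g J))
  have := hcon (g.trans e.symm) fun h1 => hg <| by
    ext1 J
    simpa [Equiv.symm_apply_eq] using DFunLike.congr_fun h1 J
  simp only [hge] at this
  exact this

end TropicalPolynomials

theorem theorem3p1 {K : Type*} [Field K] [LinearOrder K] [IsStrictOrderedRing K] (n : ℕ)
    (S : Finset (Fin n → ℕ)) (R : Finset (Fin n → K)) :
    (R.card < S.card →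
      ∃ p : TropicalPolynomial K n, p.support.Nonempty ∧ p.support ⊆ S ∧ p.VanishesOn R) ∧
    (R.card = S.card →
      ((∃ p : TropicalPolynomial K n, p.support.Nonempty ∧ p.support ⊆ S ∧ p.VanishesOn R) ↔
        Singular S R)) ∧
    (S.card < R.card →
      ((∃ p : TropicalPolynomial K n, p.support.Nonempty ∧ p.support ⊆ S ∧ p.VanishesOn R) ↔
        ∀ R' : Finset (Fin n → K), R' ⊆ R → R'.card = S.card → Singular S R')) ∧
    ((∃ p : TropicalPolynomial K n, p.support.Nonempty ∧ p.support ⊆ S ∧ p.VanishesOn R) →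
      ∃ p : TropicalPolynomial K n, p.support.Nonempty ∧ p.support = S ∧ p.VanishesOn R) := by
  -- Two empty sets are non-singular, their only bijection having no rival.
  have nonempty_of_singular : ∀ R' : Finset (Fin n → K), R'.card = S.card → Singular S R' →
      S.Nonempty := by
    intro R' hR' hsing
    by_contra hS
    rw [Finset.not_nonempty_iff_eq_empty] at hS
    subst hS
    obtain rfl : R' = ∅ := Finset.card_eq_zero.1 hR'
    exact hsing ⟨Equiv.refl _ |>.trans (Equiv.equivOfIsEmpty _ _),
      fun g hg => (hg (Subsingleton.elim _ _)).elim⟩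
  have forward : (∃ p : TropicalPolynomial K n, p.support.Nonempty ∧ p.support ⊆ S ∧
      p.VanishesOn R) → ∀ R' ⊆ R, Singular S R' := by
    rintro ⟨p, hp, hpS, hpR⟩ R' hR'
    exact singular_of_vanishesOn p hp hpS fun a ha => hpR a (hR' ha)
  have backward : S.Nonempty → (∀ R' ⊆ R, R'.card = S.card → Singular S R') →
      ∃ p : TropicalPolynomial K n, p.support.Nonempty ∧ p.support = S ∧ p.VanishesOn R := by
    intro hS h
    obtain ⟨p, hpS, hpR⟩ := exists_vanishesOn_of_singular hS h
    exact ⟨p, hpS ▸ hS, hpS, hpR⟩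
  have weaken : (∃ p : TropicalPolynomial K n, p.support.Nonempty ∧ p.support = S ∧
      p.VanishesOn R) → ∃ p : TropicalPolynomial K n, p.support.Nonempty ∧ p.support ⊆ S ∧
      p.VanishesOn R := fun ⟨p, hp, hpS, hpR⟩ => ⟨p, hp, hpS.subset, hpR⟩
  refine ⟨fun hlt => ?_, fun heq => ⟨fun h => forward h R subset_rfl, fun h => ?_⟩,
    fun hlt => ⟨fun h R' hR' _ => forward h R' hR', fun h => ?_⟩, fun h => ?_⟩
  · refine weaken (backward (Finset.card_pos.1 (Nat.zero_lt_of_lt hlt)) fun R' hR' hcard => ?_)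
    -- No `R'` is large enough, so the condition is vacuous.
    have := Finset.card_le_card hR'
    omega
  · refine weaken (backward (nonempty_of_singular R heq h) fun R' hR' hcard => ?_)
    rwa [Finset.eq_of_subset_of_card_le hR' (by omega)]
  · obtain ⟨R', hR', hcard⟩ := Finset.exists_subset_card_eq hlt.le
    exact weaken (backward (nonempty_of_singular R' hcard (h R' hR' hcard)) h)
  · obtain ⟨p, hp, hpS, -⟩ := id h
    exact backward (hp.mono hpS) fun R' hR' _ => forward h R' hR'
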